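/- Let $p$ be an odd prime, let $m$ and $k$ be positive integers, and let $e=\gcd(m,k)$. Assume that $s=m/e$ is odd, that $s\ge 3$, that $k$ is even and that $e$ is odd. Let $\lambda$ be a nonsquare in the subfield $\mathrm{GF}(p^e)$ of $\mathrm{GF}(p^m)$, let $\zeta_p\in\mathbb{C}$ be a primitive $p$-th root of unity, and let $\mathrm{Tr}$ be the trace from $\mathrm{GF}(p^m)$ to $\mathrm{GF}(p)$. For $(a,b)\in\mathrm{GF}(p^m)^2$ put $$S(a,b)=\sum_{y\in \mathrm{GF}(p)^*}\ \sum_{x\in \mathrm{GF}(p^m)}\left(\zeta_p^{\mathrm{Tr}(yax^2+ybx^{p^k+1})}+\zeta_p^{\mathrm{Tr}(-ya\lambda x^2+yb\lambda x^{p^k+1})}\right).$$ Then, as $(a,b)$ runs through $\mathrm{GF}(p^m)^2$, $S(a,b)$ takes only the following values, with the following frequencies: $2(p-1)p^m$ exactly once; $(p-1)p^{(m+e)/2}$ exactly $(p^{m-e}+p^{(m-e)/2})(p^m-1)$ times; $-(p-1)p^{(m+e)/2}$ exactly $(p^{m-e}-p^{(m-e)/2})(p^m-1)$ times; and $0$ exactly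 $(p^m-2p^{m-e}+1)(p^m-1)$ times. -/

import Mathlib

/-- The `ζ`-character sum of the theorem over a finite field `F` of characteristic `p`:
`∑_{y ∈ GF(p)^*} ∑_{x ∈ F} (ζ^{Tr(y a x² + y b x^{p^k+1})} + ζ^{Tr(-y a λ x² + y b λ x^{p^k+1})})`,
where `Tr` is the absolute trace from `F` to `GF(p) = ZMod p` and `lam` stands for `λ`.
The exponent of `ζ` is the representative in `{0, …, p-1}`, which is immaterial as `ζ^p = 1`. -/
noncomputable def expSumS (p k : ℕ) [Fact p.Prime] {F : Type*} [Field F] [Fintype F]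
    [Algebra (ZMod p) F] (ζ : ℂ) (lam a b : F) : ℂ :=
  ∑ y : (ZMod p)ˣ, ∑ x : F,
    (ζ ^ (Algebra.trace (ZMod p) F
        (algebraMap (ZMod p) F y * a * x ^ 2
          + algebraMap (ZMod p) F y * b * x ^ (p ^ k + 1))).val
      + ζ ^ (Algebra.trace (ZMod p) F
        (-(algebraMap (ZMod p) F y * a * lam * x ^ 2)
          + algebraMap (ZMod p) F y * b * lam * x ^ (p ^ k + 1))).val)

/-! Put σ(x) = x^(p^k). Then S(a,b) is a sum of two terms, each of the form ∑_y ∑_x ψ(y Q(x)), for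
the quadratic forms Q(x) = Tr(a x² + b σ(x) x) and its analogue with (-λa, λb) in place of (a,b).
Diagonalizing Q of rank r, such a term vanishes when r is odd, and is ±(p-1) p^(m - r/2) when r is
even (`QuadraticForm.sum_units_sum_apply_mul`). For (a,b) ≠ 0 the radical of Q is the solution space
of a second-order σ-equation, of dimension d ≤ 2 over GF(p^e), so r = m - ed. Since m and e are odd,
only d = 1 contributes, with absolute value (p-1) p^((m+e)/2). The two radicals cannot both be
nonzero, because σ has odd order (`eq_zero_of_solutions_of_neg`). Hence S(a,b) is 0 or ±(p-1)
p^((m+e)/2) away from the origin. The three remaining frequencies follow from the number of pairs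
(a,b) and the first two moments of S, which orthogonality of characters turns into counts of
solutions (`sum_pairSum`, `sum_pairSum_sq`). -/

/-! ### Gauss sums of quadratic forms over a finite field -/

theorem AddChar.apply_finset_sum {A M ι : Type*} [AddCommMonoid A] [CommMonoid M] (ψ : AddChar A M)
    (s : Finset ι) (f : ι → A) : ψ (∑ i ∈ s, f i) = ∏ i ∈ s, ψ (f i) := by
  classical
  induction s using Finset.induction_on with
  | empty => simp
  | insert i s hi ih => rw [Finset.sum_insert hi, Finset.prod_insert hi, map_add_eq_mul, ih]

/-- Each c is a square in 1 + χ(c) ways, χ being the quadratic character; the constant 1 contributes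
a full character sum, which is zero. -/
theorem AddChar.sum_apply_mul_sq {k : Type*} [Field k] [Fintype k] [DecidableEq k]
    (hk : ringChar k ≠ 2) {ψ : AddChar k ℂ} (hψ : ψ ≠ 1) {w : k} (hw : w ≠ 0) :
    ∑ t, ψ (w * t ^ 2) = ((quadraticChar k w : ℤ) : ℂ) *
      gaussSum ((quadraticChar k).ringHomComp (Int.castRingHom ℂ)) ψ := by
  have hprim := AddChar.IsPrimitive.of_ne_one hψ
  have h1 : ∑ t, ψ (w * t ^ 2) = ∑ c, ((quadraticChar k c : ℤ) + 1 : ℂ) * ψ (w * c) := by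
    rw [← Finset.sum_fiberwise (s := Finset.univ) (g := fun t : k ↦ t ^ 2)]
    refine Finset.sum_congr rfl fun c _ ↦ ?_
    rw [Finset.sum_congr rfl (g := fun _ ↦ ψ (w * c)) fun t ht ↦ by
      rw [(Finset.mem_filter.mp ht).2], Finset.sum_const, nsmul_eq_mul]
    congr 1
    have := quadraticChar_card_sqrts hk c
    have h2 : {x : k | x ^ 2 = c}.toFinset = Finset.univ.filter (fun x : k ↦ x ^ 2 = c) := by
      ext; simp
    rw [h2] at this
    exact_mod_cast this
  have h3 : ∑ c, ψ (w * c) = 0 := by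
    have := AddChar.sum_mulShift w hprim
    simpa [hw, mul_comm] using this
  have h4 := gaussSum_mulShift ((quadraticChar k).ringHomComp (Int.castRingHom ℂ)) ψ
    (Units.mk0 w hw)
  have h5 : ((quadraticChar k w : ℤ) : ℂ) * ((quadraticChar k w : ℤ) : ℂ) = 1 := by
    rw [← sq]; exact_mod_cast quadraticChar_sq_one hw
  rw [h1, ← h4]
  simp only [add_mul, one_mul, Finset.sum_add_distrib, h3, add_zero, gaussSum,
    MulChar.ringHomComp_apply, AddChar.mulShift_apply, Units.val_mk0, eq_intCast]
  rw [← mul_assoc, h5, one_mul]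

theorem AddChar.sum_apply_weightedSumSquares {k ι : Type*} [Field k] [Fintype k] [DecidableEq k]
    [Fintype ι] [DecidableEq ι] (hk : ringChar k ≠ 2) {ψ : AddChar k ℂ} (hψ : ψ ≠ 1) (w : ι → k) {y : k}
    (hy : y ≠ 0) :
    ∑ v : ι → k, ψ (y * QuadraticMap.weightedSumSquares k w v) =
      ∏ i, if w i = 0 then (Fintype.card k : ℂ) else
        ((quadraticChar k y : ℤ) : ℂ) * ((quadraticChar k (w i) : ℤ) : ℂ) *
        gaussSum ((quadraticChar k).ringHomComp (Int.castRingHom ℂ)) ψ := by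
  have h1 : ∀ v : ι → k, ψ (y * QuadraticMap.weightedSumSquares k w v) =
      ∏ i, ψ (y * w i * (v i) ^ 2) := by
    intro v
    rw [QuadraticMap.weightedSumSquares_apply, Finset.mul_sum]
    rw [AddChar.apply_finset_sum]
    refine Finset.prod_congr rfl fun i _ ↦ ?_
    rw [smul_eq_mul]
    ring_nf
  simp_rw [h1]
  rw [← Fintype.prod_sum (fun i t ↦ ψ (y * w i * t ^ 2))]
  refine Finset.prod_congr rfl fun i _ ↦ ?_
  split_ifs with h
  · simp [h]
  · rw [AddChar.sum_apply_mul_sq hk hψ (mul_ne_zero hy h), map_mul]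
    push_cast
    ring

theorem card_radical_weightedSumSquares {k ι : Type*} [Field k] [Fintype k] [DecidableEq k]
    [Fintype ι] [DecidableEq ι] (hk : ringChar k ≠ 2) (w : ι → k) :
    Nat.card {v : ι → k // ∀ v', QuadraticMap.polar (QuadraticMap.weightedSumSquares k w) v v' = 0} =
      Fintype.card k ^ (Finset.univ.filter (fun i ↦ w i = 0)).card := by
  have h2 : (2 : k) ≠ 0 := Ring.two_ne_zero hk
  have hp : ∀ v v', QuadraticMap.polar (QuadraticMap.weightedSumSquares k w) v v' =
      ∑ i, 2 * w i * v i * v' i := by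
    intro v v'
    simp only [QuadraticMap.polar, QuadraticMap.weightedSumSquares_apply, smul_eq_mul,
      Pi.add_apply, ← Finset.sum_sub_distrib]
    exact Finset.sum_congr rfl fun i _ ↦ by ring
  have hm : ∀ v : ι → k,
      (∀ v', QuadraticMap.polar (QuadraticMap.weightedSumSquares k w) v v' = 0) ↔
      v ∈ Fintype.piFinset fun i ↦ Finset.univ.filter (fun t : k ↦ w i * t = 0) := by
    intro v
    simp only [hp, Fintype.mem_piFinset, Finset.mem_filter, Finset.mem_univ, true_and]
    constructor
    · intro h i
      have := h (Pi.single i 1)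
      rw [Finset.sum_eq_single i (fun j _ hj ↦ by simp [hj]) (by simp)] at this
      simp only [Pi.single_eq_same, mul_one, mul_assoc] at this
      exact (mul_eq_zero.mp this).resolve_left h2
    · intro h v'
      exact Finset.sum_eq_zero fun i _ ↦ by rw [mul_assoc 2, h i]; simp
  rw [Nat.card_congr (Equiv.subtypeEquivRight hm), Nat.card_eq_fintype_card, Fintype.card_coe,
    Fintype.card_piFinset, ← Finset.prod_const, Finset.prod_filter]
  refine Finset.prod_congr rfl fun i _ ↦ ?_
  split_ifs with h
  · simp [h]
  · simp [h, Finset.filter_eq']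

/-- Here r is the rank and z the dimension of the radical. After diagonalization y enters only
through χ(y)^r: for odd r this is χ(y), which sums to zero, and for even r it is 1. -/
theorem QuadraticForm.sum_units_sum_apply_mul {k V : Type*} [Field k] [Fintype k] [DecidableEq k]
    [AddCommGroup V] [Module k V] [Fintype V]
    (hk : ringChar k ≠ 2) {ψ : AddChar k ℂ} (hψ : ψ ≠ 1) (Q : QuadraticForm k V) :
    ∃ r z : ℕ, r + z = Module.finrank k V ∧
      Nat.card {v : V // ∀ v', QuadraticMap.polar Q v v' = 0} = Fintype.card k ^ z ∧
      (Odd r → ∑ y : kˣ, ∑ v, ψ (y * Q v) = 0) ∧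
      (Even r → ∃ ε : ℤ, (ε = 1 ∨ ε = -1) ∧ ∑ y : kˣ, ∑ v, ψ (y * Q v) =
        ε * (((Fintype.card k : ℂ) - 1) * (Fintype.card k : ℂ) ^ (z + r / 2))) := by
  have h2 : (2 : k) ≠ 0 := Ring.two_ne_zero hk
  let _ : Invertible (2 : k) := invertibleOfNonzero h2
  obtain ⟨w, ⟨f⟩⟩ := QuadraticForm.equivalent_weightedSumSquares Q
  set g := gaussSum ((quadraticChar k).ringHomComp (Int.castRingHom ℂ)) ψ with hg
  set A := Finset.univ.filter (fun i ↦ w i = 0)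
  set B := Finset.univ.filter (fun i ↦ ¬ w i = 0)
  have hBA : B.card + A.card = Module.finrank k V := by
    rw [add_comm, Finset.card_filter_add_card_filter_not]; simp
  set δ : ℤ := ∏ i ∈ B, quadraticChar k (w i)
  have hδ : δ = 1 ∨ δ = -1 := by
    rw [← sq_eq_one_iff]
    rw [← Finset.prod_pow]
    exact Finset.prod_eq_one fun i hi ↦ quadraticChar_sq_one (Finset.mem_filter.mp hi).2
  have hsum : ∀ y : kˣ, ∑ v, ψ (y * Q v) = ((quadraticChar k y : ℤ) : ℂ) ^ B.card *
      ((Fintype.card k : ℂ) ^ A.card * δ * g ^ B.card) := by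
    intro y
    have h1 : ∑ v, ψ (y * Q v) = ∑ v, ψ (y * QuadraticMap.weightedSumSquares k w v) :=
      Fintype.sum_equiv f.toEquiv _ _ fun v ↦ by
        congr 2
        exact (f.map_app v).symm
    rw [h1, AddChar.sum_apply_weightedSumSquares hk hψ w y.ne_zero, Finset.prod_ite,
      Finset.prod_const, Finset.prod_mul_distrib, Finset.prod_mul_distrib, Finset.prod_const,
      Finset.prod_const]
    push_cast [δ]
    ring
  have hg2 : g ^ 2 = ((quadraticChar k (-1) : ℤ) : ℂ) * Fintype.card k := by
    rw [hg, gaussSum_sq]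
    · simp
    · rw [MulChar.ringHomComp_ne_one_iff (RingHom.injective_int _)]
      exact quadraticChar_ne_one hk
    · exact (quadraticChar_isQuadratic k).comp _
    · exact AddChar.IsPrimitive.of_ne_one hψ
  refine ⟨B.card, A.card, hBA, ?_, ?_, ?_⟩
  · rw [← card_radical_weightedSumSquares hk w]
    refine Nat.card_congr (Equiv.subtypeEquiv f.toEquiv fun v ↦ ?_)
    have hpol : ∀ v v', QuadraticMap.polar (QuadraticMap.weightedSumSquares k w) (f v) (f v') =
        QuadraticMap.polar Q v v' := by
      intro v v'
      simp only [QuadraticMap.polar, ← map_add, f.map_app]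
    constructor
    · intro h v'
      obtain ⟨u, rfl⟩ := f.toEquiv.surjective v'
      exact (hpol v u).trans (h u)
    · intro h v'
      exact (hpol v v').symm.trans (h _)
  · intro hr
    have h0 : ∑ y : kˣ, (quadraticChar k y : ℤ) = 0 := by
      have := quadraticChar_sum_zero hk
      rw [← Finset.sum_erase _ (quadraticChar_zero (F := k))] at this
      rw [← this]
      refine Finset.sum_bij (fun y _ ↦ (y : k)) (by simp) (by simp [Units.ext_iff]) ?_ (by simp)
      intro b hb
      exact ⟨Units.mk0 b (by simpa using hb), by simp⟩
    have h3 : ∀ y : kˣ, ((quadraticChar k y : ℤ) : ℂ) ^ B.card = ((quadraticChar k y : ℤ) : ℂ) := by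
      intro y
      obtain ⟨j, hj⟩ := hr
      rw [hj, pow_succ, pow_mul]
      have : ((quadraticChar k y : ℤ) : ℂ) ^ 2 = 1 := by
        exact_mod_cast quadraticChar_sq_one y.ne_zero
      rw [this]; simp
    simp_rw [hsum, h3]
    rw [← Finset.sum_mul]
    have : ∑ y : kˣ, ((quadraticChar k y : ℤ) : ℂ) = 0 := by exact_mod_cast h0
    rw [this, zero_mul]
  · rintro ⟨j, hj⟩
    have h3 : ∀ y : kˣ, ((quadraticChar k y : ℤ) : ℂ) ^ B.card = 1 := by
      intro y
      rw [hj, ← two_mul, pow_mul]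
      have : ((quadraticChar k y : ℤ) : ℂ) ^ 2 = 1 := by
        exact_mod_cast quadraticChar_sq_one y.ne_zero
      rw [this]; simp
    -- With r = 2j, the Gauss sum gives g^r = (χ(-1) q)^j, where q is the size of the field; δ
    -- collects the signs of the diagonal coefficients.
    refine ⟨δ * quadraticChar k (-1) ^ j, ?_, ?_⟩
    · rcases hδ with h | h <;>
      rcases quadraticChar_dichotomy (F := k) (a := -1) (by simp) with h' | h' <;>
      rw [h, h'] <;> rcases neg_one_pow_eq_or ℤ j with h'' | h'' <;> simp [h'']
    · simp_rw [hsum, h3]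
      rw [Finset.sum_const, Finset.card_univ, Fintype.card_units, nsmul_eq_mul, one_mul,
        hj, ← two_mul, pow_mul g, hg2, Nat.mul_div_cancel_left _ (by norm_num : 0 < 2),
        Nat.cast_sub Fintype.card_pos]
      push_cast
      ring

/-! ### Semilinear equations in σ -/

section SemilinearEquation

variable {K F : Type*} [Field K] [Field F] [Algebra K F]

/-- The space of solutions of the second order equation `A σ²(x) + B σ(x) + C x = 0`. -/
def secondOrderSolutions (σ : F ≃ₐ[K] F) (A B C : F) : Submodule K F where
  carrier := {x | A * σ (σ x) + B * σ x + C * x = 0}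
  zero_mem' := by simp
  add_mem' {x y} hx hy := by
    simp only [Set.mem_ofPred_eq, map_add] at *
    linear_combination hx + hy
  smul_mem' c x hx := by
    simp only [Set.mem_ofPred_eq, Algebra.smul_def, map_mul, AlgEquiv.commutes] at *
    linear_combination (algebraMap K F c) * hx

theorem mem_secondOrderSolutions {σ : F ≃ₐ[K] F} {A B C x : F} :
    x ∈ secondOrderSolutions σ A B C ↔ A * σ (σ x) + B * σ x + C * x = 0 := Iff.rfl

/-- Reduction of order, as for linear differential equations: with a solution u ≠ 0 and x = uz, the
difference σ(z) - z satisfies a first-order equation, two solutions of which have a ratio fixed by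
σ. -/
theorem finrank_secondOrderSolutions_le_two [FiniteDimensional K F] {σ : F ≃ₐ[K] F}
    (hfix : ∀ x, σ x = x → ∃ c, algebraMap K F c = x) {A B C : F} (hA : A ≠ 0) :
    Module.finrank K (secondOrderSolutions σ A B C) ≤ 2 := by
  set R := secondOrderSolutions σ A B C
  by_cases hR : R = ⊥
  · rw [hR]; simp
  obtain ⟨u, huR, hu⟩ := R.ne_bot_iff.mp hR
  have hσu : σ u ≠ 0 := by simpa using hu
  have hσσu : σ (σ u) ≠ 0 := by simpa using hu
  -- This sends x to σ(x/u) - x/u, so its kernel is the line K u.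
  let φ : R →ₗ[K] F :=
    ((σ.toLinearMap - LinearMap.id).comp (LinearMap.mulLeft K u⁻¹)).comp R.subtype
  have hφ : ∀ x : R, φ x = σ (u⁻¹ * x) - u⁻¹ * x := fun x ↦ by simp [φ]
  have hker : Module.finrank K (LinearMap.ker φ) ≤ 1 := by
    refine finrank_le_one ⟨⟨u, huR⟩, by simp [hφ, hu]⟩ ?_
    rintro ⟨⟨x, hx⟩, hx'⟩
    rw [LinearMap.mem_ker, hφ, sub_eq_zero] at hx'
    obtain ⟨c, hc⟩ := hfix _ hx'
    refine ⟨c, ?_⟩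
    ext
    simp only [SetLike.val_smul, Algebra.smul_def, hc]
    field_simp
  have hrec : ∀ w ∈ LinearMap.range φ, A * σ (σ u) * σ w = C * u * w := by
    rintro _ ⟨⟨x, hx⟩, rfl⟩
    have huR' := mem_secondOrderSolutions.mp huR
    have hx' := mem_secondOrderSolutions.mp hx
    obtain ⟨z, rfl⟩ : ∃ z, x = u * z := ⟨u⁻¹ * x, by field_simp⟩
    simp only [map_mul] at hx'
    rw [hφ]
    simp only [inv_mul_cancel_left₀ hu, map_sub]
    linear_combination hx' - σ z * huR'
  have hrange : Module.finrank K (LinearMap.range φ) ≤ 1 := by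
    by_cases hb : LinearMap.range φ = ⊥
    · rw [hb]; simp
    obtain ⟨v, hv, hv0⟩ := (LinearMap.range φ).ne_bot_iff.mp hb
    refine finrank_le_one ⟨v, hv⟩ ?_
    rintro ⟨w, hw⟩
    have h1 := hrec v hv
    have h2 := hrec w hw
    have hσv : σ v ≠ 0 := by simpa using hv0
    obtain ⟨c, hc⟩ := hfix (w / v) (by
      rw [map_div₀, div_eq_div_iff hσv hv0]
      refine mul_left_cancel₀ (mul_ne_zero hA hσσu) ?_
      linear_combination v * h2 - w * h1)
    refine ⟨c, ?_⟩
    ext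
    simp only [SetLike.val_smul, Algebra.smul_def, hc]
    field_simp
  have := LinearMap.finrank_range_add_finrank_ker φ
  omega

end SemilinearEquation

/-- Applying σ an odd number s of times gives x = -x. -/
theorem eq_zero_of_map_eq_neg {F : Type*} [Field F] (h2 : (2 : F) ≠ 0) {σ : F →+* F} {s : ℕ}
    (hs : Odd s) (hσ : ∀ x, σ^[s] x = x) {x : F} (hx : σ x = -x) : x = 0 := by
  have h : ∀ n, σ^[n] x = (-1) ^ n * x := by
    intro n
    induction n with
    | zero => simp
    | succ n ih => rw [Function.iterate_succ_apply', ih, map_mul, hx]; simp [pow_succ]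
  have h1 := hσ x
  rw [h, hs.neg_one_pow] at h1
  have : 2 * x = 0 := by linear_combination -h1
  exact (mul_eq_zero.mp this).resolve_left h2

/-- Eliminating a from the two equations shows that σ negates b(x σ(y) + y σ(x)), which is therefore
zero. If b and x are nonzero, σ then negates y/x, so y = 0. -/
theorem eq_zero_of_solutions_of_neg {F : Type*} [Field F] (h2 : (2 : F) ≠ 0) {σ : F →+* F} {s : ℕ}
    (hs : Odd s) (hσ : ∀ x, σ^[s] x = x) {a b x y : F} (hab : a ≠ 0 ∨ b ≠ 0)
    (hx : σ b * σ (σ x) + 2 * σ a * σ x + b * x = 0)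
    (hy : σ b * σ (σ y) + 2 * σ (-a) * σ y + b * y = 0) : x = 0 ∨ y = 0 := by
  by_cases hb : b = 0
  · have ha := hab.resolve_right (not_not.mpr hb)
    left
    simpa [hb, h2, ha] using hx
  have h1 : σ (b * (x * σ y + y * σ x)) = -(b * (x * σ y + y * σ x)) := by
    simp only [map_add, map_mul, map_neg] at *
    linear_combination σ y * hx + σ x * hy
  have h3 := (mul_eq_zero.mp (eq_zero_of_map_eq_neg h2 hs hσ h1)).resolve_left hb
  by_cases hx0 : x = 0
  · exact Or.inl hx0
  right
  have hσx : σ x ≠ 0 := by simpa using hx0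
  have h4 : σ (y / x) = -(y / x) := by
    rw [map_div₀, ← neg_div, div_eq_div_iff hσx hx0]
    linear_combination h3
  have h5 := eq_zero_of_map_eq_neg h2 hs hσ h4
  simpa [hx0] using h5

/-! ### The trace forms and their radicals -/

section TraceForm

variable {k F : Type*} [Field k] [Field F] [Algebra k F]

/-- The quadratic form `x ↦ Tr (a x² + b σ(x) x)`. -/
noncomputable def traceQuadraticForm (σ : F ≃ₐ[k] F) (a b : F) : QuadraticForm k F :=
  LinearMap.BilinMap.toQuadraticMap (LinearMap.mk₂ k
    (fun x y ↦ Algebra.trace k F (a * x * y + b * σ x * y))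
    (fun x x' y ↦ by rw [← map_add]; congr 1; simp only [map_add]; ring)
    (fun c x y ↦ by
      rw [← map_smul]; congr 1; simp only [Algebra.smul_def, map_mul, AlgEquiv.commutes]; ring)
    (fun x y y' ↦ by rw [← map_add]; congr 1; ring)
    (fun c x y ↦ by rw [← map_smul]; congr 1; simp only [Algebra.smul_def]; ring))

theorem traceQuadraticForm_apply (σ : F ≃ₐ[k] F) (a b x : F) :
    traceQuadraticForm σ a b x = Algebra.trace k F (a * x * x + b * σ x * x) := rfl

/-- Invariance of the trace under σ lets the polar form be paired with σ(y) instead of y, which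
avoids σ⁻¹; nondegeneracy of the trace form concludes. -/
theorem polar_traceQuadraticForm_eq_zero_iff [FiniteDimensional k F] [Algebra.IsSeparable k F]
    (σ : F ≃ₐ[k] F) (a b x : F) :
    (∀ y, QuadraticMap.polar (traceQuadraticForm σ a b) x y = 0) ↔
      σ b * σ (σ x) + 2 * σ a * σ x + b * x = 0 := by
  have h : ∀ y, QuadraticMap.polar (traceQuadraticForm σ a b) x y =
      Algebra.traceForm k F (σ b * σ (σ x) + 2 * σ a * σ x + b * x) (σ y) := by
    intro y
    rw [Algebra.traceForm_apply]
    have h1 : QuadraticMap.polar (traceQuadraticForm σ a b) x y =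
        Algebra.trace k F ((2 * a * x + b * σ x) * y) + Algebra.trace k F (b * x * σ y) := by
      rw [← map_add]
      simp only [QuadraticMap.polar, traceQuadraticForm_apply, ← map_sub]
      congr 1
      simp only [map_add]
      ring
    rw [h1, ← Algebra.trace_eq_of_algEquiv σ ((2 * a * x + b * σ x) * y), ← map_add]
    congr 1
    simp only [map_add, map_mul, map_ofNat]
    ring
  simp only [h]
  constructor
  · intro h0
    refine (traceForm_nondegenerate k F).1 _ fun y ↦ ?_
    obtain ⟨z, rfl⟩ := σ.surjective y
    exact h0 z
  · intro h0 y
    simp [h0]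

end TraceForm

theorem sum_units_traceQuadraticForm {k K F : Type*} [Field k] [Fintype k] [DecidableEq k] [Field K] [Finite K]
    [Field F] [Fintype F] [Algebra k F] [Algebra K F] (hk : ringChar k ≠ 2) {ψ : AddChar k ℂ}
    (hψ : ψ ≠ 1) (σ : F ≃ₐ[k] F) (σK : F ≃ₐ[K] F) (hσK : ∀ x, σK x = σ x)
    (hfix : ∀ x, σ x = x → ∃ c, algebraMap K F c = x) {e s : ℕ} (he : Odd e) (hs : Odd s)
    (hs3 : 3 ≤ s) (hK : Nat.card K = Fintype.card k ^ e) (hF : Module.finrank k F = e * s)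
    {a b : F} (hab : a ≠ 0 ∨ b ≠ 0) :
    ∑ y : kˣ, ∑ x, ψ (y * traceQuadraticForm σ a b x) = 0 ∨
    (∃ x ≠ 0, σ b * σ (σ x) + 2 * σ a * σ x + b * x = 0) ∧ ∃ ε : ℤ, (ε = 1 ∨ ε = -1) ∧
      ∑ y : kˣ, ∑ x, ψ (y * traceQuadraticForm σ a b x) =
        ε * (((Fintype.card k : ℂ) - 1) * (Fintype.card k : ℂ) ^ ((e * s + e) / 2)) := by
  have h2 : (2 : k) ≠ 0 := Ring.two_ne_zero hk
  have h2F : (2 : F) ≠ 0 := by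
    rw [← map_ofNat (algebraMap k F) 2]; simpa using h2
  obtain ⟨r, z, hrz, hcard, hodd, heven⟩ :=
    QuadraticForm.sum_units_sum_apply_mul hk hψ (traceQuadraticForm σ a b)
  simp only [polar_traceQuadraticForm_eq_zero_iff] at hcard
  set R := secondOrderSolutions σK (σ b) (2 * σ a) b with hRdef
  have hmem : ∀ x, x ∈ R ↔ σ b * σ (σ x) + 2 * σ a * σ x + b * x = 0 := by
    intro x
    rw [hRdef, mem_secondOrderSolutions, hσK, hσK]
  have hcR : Nat.card R = Fintype.card k ^ z := by
    rw [← hcard]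
    exact Nat.card_congr (Equiv.subtypeEquivRight hmem)
  have hd2 : Module.finrank K R ≤ 2 := by
    by_cases hb : b = 0
    · have ha := hab.resolve_right (not_not.mpr hb)
      have : R = ⊥ := by
        rw [eq_bot_iff]
        intro x hx
        rw [hmem] at hx
        simpa [hb, h2F, ha] using hx
      rw [this]; simp
    · refine finrank_secondOrderSolutions_le_two (fun x hx ↦ hfix x ?_) (by simpa using hb)
      rw [← hσK, hx]
  have hz : z = e * Module.finrank K R := by
    rw [Module.natCard_eq_pow_finrank (K := K), hK, ← pow_mul] at hcR
    exact (Nat.pow_right_injective Fintype.one_lt_card hcR).symm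
  have hes : Odd (e * s) := he.mul hs
  rw [hF] at hrz
  obtain ⟨e', rfl⟩ := he
  obtain ⟨s', rfl⟩ := hs
  generalize hd : Module.finrank K R = d at *
  -- The rank is e(s - d): odd for d = 0 and d = 2, even for d = 1.
  interval_cases d
  · left
    apply hodd
    rw [hz] at hrz
    simpa [← hrz] using hes
  · right
    have hr : r = 2 * ((2 * e' + 1) * s') := by
      rw [hz] at hrz
      linarith
    obtain ⟨ε, hε, hsum⟩ := heven (hr ▸ even_two_mul _)
    constructor
    · have : R ≠ ⊥ := by
        rintro h
        rw [h] at hd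
        simp at hd
      obtain ⟨x, hx, hx0⟩ := R.ne_bot_iff.mp this
      exact ⟨x, hx0, (hmem x).mp hx⟩
    · refine ⟨ε, hε, ?_⟩
      rw [hsum]
      congr 3
      rw [hz, hr]
      have : (2 * e' + 1) * (2 * s' + 1) + (2 * e' + 1) = 2 * ((2 * e' + 1) + (2 * e' + 1) * s') := by
        ring
      rw [this]
      simp
  · left
    apply hodd
    rw [hz] at hrz
    have := hrz ▸ hes
    rw [Nat.odd_add] at this
    exact this.mpr (by simp)

/-! ### Moments of character sums as solution counts -/

section CharacterMoments

variable {F : Type*} [Field F] [Fintype F] [DecidableEq F]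

theorem AddChar.sum_prod_apply {ψ : AddChar F ℂ} (hψ : ψ ≠ 1) (u v : F) :
    ∑ ab : F × F, ψ (ab.1 * u + ab.2 * v) =
      if u = 0 ∧ v = 0 then (Fintype.card F : ℂ) ^ 2 else 0 := by
  have hprim := AddChar.IsPrimitive.of_ne_one hψ
  rw [Fintype.sum_prod_type]
  simp only [map_add_eq_mul, ← Finset.mul_sum, ← Finset.sum_mul, AddChar.sum_mulShift _ hprim]
  split_ifs <;> simp_all [sq]

theorem AddChar.sum_prod_sum_apply {ψ : AddChar F ℂ} (hψ : ψ ≠ 1) {I : Type*} [Fintype I]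
    (u v : I → F) :
    ∑ ab : F × F, ∑ i, ψ (ab.1 * u i + ab.2 * v i) =
      (Fintype.card F : ℂ) ^ 2 * (Finset.univ.filter fun i ↦ u i = 0 ∧ v i = 0).card := by
  rw [Finset.sum_comm]
  simp only [AddChar.sum_prod_apply hψ]
  rw [← Finset.sum_filter, Finset.sum_const, nsmul_eq_mul, mul_comm]

theorem AddChar.sum_prod_sum_mul_sum_apply {ψ : AddChar F ℂ} (hψ : ψ ≠ 1) {I J : Type*} [Fintype I]
    [Fintype J] (u v : I → F) (u' v' : J → F) :
    ∑ ab : F × F, (∑ i, ψ (ab.1 * u i + ab.2 * v i)) * (∑ j, ψ (ab.1 * u' j + ab.2 * v' j)) =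
      (Fintype.card F : ℂ) ^ 2 *
        ∑ i, ((Finset.univ.filter fun j ↦ u i + u' j = 0 ∧ v i + v' j = 0).card : ℂ) := by
  have h : ∀ ab : F × F,
      (∑ i, ψ (ab.1 * u i + ab.2 * v i)) * (∑ j, ψ (ab.1 * u' j + ab.2 * v' j)) =
      ∑ i, ∑ j, ψ (ab.1 * (u i + u' j) + ab.2 * (v i + v' j)) := by
    intro ab
    rw [Finset.sum_mul_sum]
    refine Finset.sum_congr rfl fun i _ ↦ Finset.sum_congr rfl fun j _ ↦ ?_
    rw [← map_add_eq_mul]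
    congr 1
    ring
  simp only [h]
  rw [Finset.sum_comm, Finset.mul_sum]
  exact Finset.sum_congr rfl fun i _ ↦ AddChar.sum_prod_sum_apply hψ _ _

end CharacterMoments

/-- The degree of c over k is at most 2 and divides an odd number. -/
theorem exists_algebraMap_eq_of_sq {k F : Type*} [Field k] [Field F] [Algebra k F]
    [FiniteDimensional k F] (hodd : Odd (Module.finrank k F)) {c : F} {u : k}
    (hc : c ^ 2 = algebraMap k F u) : ∃ d, algebraMap k F d = c := by
  have hint : IsIntegral k c := IsIntegral.of_finite k c
  have hle : (minpoly k c).natDegree ≤ 2 := by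
    have h := minpoly.min k c (p := Polynomial.X ^ 2 - Polynomial.C u)
      (Polynomial.monic_X_pow_sub_C u two_ne_zero) (by simp [hc])
    have := Polynomial.natDegree_le_natDegree h
    rwa [Polynomial.natDegree_X_pow_sub_C] at this
  have hpos := minpoly.natDegree_pos hint
  have hne : (minpoly k c).natDegree ≠ 2 := by
    intro h
    have hd := minpoly.degree_dvd hint
    rw [h] at hd
    exact (Nat.not_even_iff_odd.mpr hodd) (even_iff_two_dvd.mpr hd)
  exact minpoly.natDegree_eq_one_iff.mp (by omega)

theorem card_filter_zero {k F : Type*} [Field k] [Fintype k] [DecidableEq k] [Field F] [Fintype F]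
    [DecidablePred fun j : kˣ × F ↦ j.2 = 0] :
    (Finset.univ.filter fun j : kˣ × F ↦ j.2 = 0).card = Fintype.card kˣ := by
  have : (Finset.univ.filter fun j : kˣ × F ↦ j.2 = 0) =
      (Finset.univ : Finset kˣ) ×ˢ ({0} : Finset F) := by
    ext ⟨y, x⟩; simp [eq_comm]
  rw [this, Finset.card_product]
  simp

section PairCounts

variable {k F : Type*} [Field k] [Fintype k] [DecidableEq k] [Field F] [Fintype F] [DecidableEq F]
  [Algebra k F]

/-- For x ≠ 0 the first equation makes (x'/x)² an element of k, so x' = cx with c in k by `hsq`;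
each unit c then forces y' = -y/c², and the second equation holds automatically because σ fixes c.
-/
theorem card_filter_same (hsq : ∀ (c : F) (u : k), c ^ 2 = algebraMap k F u →
      ∃ d, algebraMap k F d = c) (σ : F ≃ₐ[k] F) (i : kˣ × F) :
    (Finset.univ.filter fun j : kˣ × F ↦
      algebraMap k F i.1 * i.2 ^ 2 + algebraMap k F j.1 * j.2 ^ 2 = 0 ∧
      algebraMap k F i.1 * (σ i.2 * i.2) + algebraMap k F j.1 * (σ j.2 * j.2) = 0).card =
      Fintype.card kˣ := by
  obtain ⟨y, x⟩ := i
  by_cases hx : x = 0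
  · rw [← card_filter_zero (k := k) (F := F)]
    congr 1
    ext ⟨y', x'⟩
    simp only [hx, Finset.mem_filter, Finset.mem_univ, true_and]
    simp
  have hunit : ∀ y : kˣ, algebraMap k F y ≠ 0 := fun y ↦ by simp
  rw [← Finset.card_univ, ← Finset.card_image_of_injective Finset.univ
    (f := fun c : kˣ ↦ ((-y * (c ^ 2)⁻¹, algebraMap k F c * x) : kˣ × F))]
  · congr 1
    ext ⟨y', x'⟩
    simp only [Finset.mem_filter, Finset.mem_univ, true_and, Finset.mem_image, Prod.mk.injEq]
    constructor
    · rintro ⟨h1, h2⟩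
      have hx' : x' ≠ 0 := by
        rintro rfl
        simp [hx] at h1
      obtain ⟨d, hd⟩ := hsq (x' / x) (-y * (y' : k)⁻¹) (by
        have := hunit y'
        simp only [map_mul, map_neg, map_inv₀]
        field_simp
        linear_combination h1)
      have hd0 : d ≠ 0 := by
        rintro rfl
        rw [map_zero] at hd
        exact div_ne_zero hx' hx hd.symm
      have hx'd : x' = algebraMap k F d * x := by rw [hd]; field_simp
      refine ⟨Units.mk0 d hd0, ?_, by simp [hx'd]⟩
      have h3 : (y : k) + y' * d ^ 2 = 0 := by
        apply (algebraMap k F).injective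
        rw [hx'd] at h1
        refine mul_right_cancel₀ (pow_ne_zero 2 hx) ?_
        simp only [map_add, map_mul, map_pow, map_zero]
        linear_combination h1
      ext
      simp only [Units.val_mul, Units.val_neg, Units.val_inv_eq_inv_val, Units.val_pow_eq_pow_val,
        Units.val_mk0]
      field_simp
      linear_combination -h3
    · rintro ⟨c, rfl, rfl⟩
      have := hunit c
      simp only [Units.val_mul, Units.val_neg, Units.val_inv_eq_inv_val, Units.val_pow_eq_pow_val,
        map_mul, map_neg, map_inv₀, map_pow, AlgEquiv.commutes]
      constructor <;> field_simp <;> ring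
  · intro c c' h
    have := (Prod.mk.inj h).2
    have := mul_right_cancel₀ hx this
    exact Units.ext ((algebraMap k F).injective this)

/-- The opposite signs in the two equations force σ(x'/x) = -x'/x when x ≠ 0, which is impossible
for σ of odd order. -/
theorem card_filter_cross (h2 : (2 : F) ≠ 0) {s : ℕ} (hs : Odd s) (σ : F ≃ₐ[k] F)
    (hσ : ∀ x, (σ : F →+* F)^[s] x = x) {lam : F} (hlam : lam ≠ 0) (i : kˣ × F) :
    (Finset.univ.filter fun j : kˣ × F ↦
      algebraMap k F i.1 * i.2 ^ 2 + -(algebraMap k F j.1 * lam * j.2 ^ 2) = 0 ∧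
      algebraMap k F i.1 * (σ i.2 * i.2) + algebraMap k F j.1 * lam * (σ j.2 * j.2) = 0).card =
      if i.2 = 0 then Fintype.card kˣ else 0 := by
  obtain ⟨y, x⟩ := i
  have hunit : ∀ y : kˣ, algebraMap k F y ≠ 0 := fun y ↦ by simp
  split_ifs with hx
  · rw [← card_filter_zero (k := k) (F := F)]
    congr 1
    ext ⟨y', x'⟩
    simp only at hx
    simp only [hx, Finset.mem_filter, Finset.mem_univ, true_and]
    simp [hlam]
  · rw [Finset.card_eq_zero, Finset.filter_eq_empty_iff]
    rintro ⟨y', x'⟩ _ ⟨h1, h2'⟩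
    simp only at hx h1 h2'
    have hx' : x' ≠ 0 := by
      rintro rfl
      simp [hx] at h1
    have hσx' : σ x' ≠ 0 := by simpa using hx'
    have h3 : σ (x' / x) = -(x' / x) := by
      have hσx : σ x ≠ 0 := by simpa using hx
      rw [map_div₀, ← neg_div, div_eq_div_iff hσx hx]
      refine mul_left_cancel₀ (mul_ne_zero (mul_ne_zero (hunit y') hlam) hx') ?_
      linear_combination x * h2' - σ x * h1
    have := eq_zero_of_map_eq_neg h2 hs hσ (x := x' / x) h3
    simp [hx, hx'] at this

end PairCounts

section Moments

variable {k F : Type*} [Field k] [Fintype k] [DecidableEq k] [Field F] [Fintype F] [Algebra k F]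

/-- The exponential sum `∑_y ∑_x ψ (a y x² + b y σ(x) x)` plus its twist by `lam`. -/
noncomputable def pairSum (ψ : AddChar F ℂ) (σ : F ≃ₐ[k] F) (lam a b : F) : ℂ :=
  ∑ i : kˣ × F, ψ (a * (algebraMap k F i.1 * i.2 ^ 2) + b * (algebraMap k F i.1 * (σ i.2 * i.2))) +
  ∑ i : kˣ × F, ψ (a * -(algebraMap k F i.1 * lam * i.2 ^ 2) +
    b * (algebraMap k F i.1 * lam * (σ i.2 * i.2)))

theorem sum_pairSum {ψ : AddChar F ℂ} (hψ : ψ ≠ 1) (σ : F ≃ₐ[k] F) {lam : F} (hlam : lam ≠ 0) :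
    ∑ ab : F × F, pairSum ψ σ lam ab.1 ab.2 =
      2 * Fintype.card kˣ * (Fintype.card F : ℂ) ^ 2 := by
  classical
  simp only [pairSum, Finset.sum_add_distrib]
  rw [AddChar.sum_prod_sum_apply hψ, AddChar.sum_prod_sum_apply hψ]
  have h : ∀ l : F, l ≠ 0 → ∀ i : kˣ × F, (-(algebraMap k F i.1 * l * i.2 ^ 2) = 0 ∧
      algebraMap k F i.1 * l * (σ i.2 * i.2) = 0) ↔ i.2 = 0 := by
    intro l hl i
    simp [hl]
  have h' : ∀ i : kˣ × F, (algebraMap k F i.1 * i.2 ^ 2 = 0 ∧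
      algebraMap k F i.1 * (σ i.2 * i.2) = 0) ↔ i.2 = 0 := by
    intro i
    simp
  simp only [h lam hlam, h', card_filter_zero]
  ring

theorem sum_pairSum_sq {ψ : AddChar F ℂ} (hψ : ψ ≠ 1) (σ : F ≃ₐ[k] F) {lam : F} (hlam : lam ≠ 0)
    (hodd : Odd (Module.finrank k F)) (h2 : (2 : F) ≠ 0) {s : ℕ} (hs : Odd s)
    (hσ : ∀ x, (σ : F →+* F)^[s] x = x) :
    ∑ ab : F × F, pairSum ψ σ lam ab.1 ab.2 ^ 2 =
      2 * (Fintype.card kˣ : ℂ) ^ 2 * (Fintype.card F : ℂ) ^ 2 * (Fintype.card F + 1) := by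
  classical
  have := fun (c : F) (u : k) ↦ exists_algebraMap_eq_of_sq hodd (c := c) (u := u)
  simp only [pairSum, add_sq, Finset.sum_add_distrib, mul_assoc (2 : ℂ), ← Finset.mul_sum]
  simp only [sq (Finset.sum _ _)]
  rw [AddChar.sum_prod_sum_mul_sum_apply hψ, AddChar.sum_prod_sum_mul_sum_apply hψ,
    AddChar.sum_prod_sum_mul_sum_apply hψ]
  have h : ∀ i j : kˣ × F, (-(algebraMap k F i.1 * lam * i.2 ^ 2) +
      -(algebraMap k F j.1 * lam * j.2 ^ 2) = 0 ∧
      algebraMap k F i.1 * lam * (σ i.2 * i.2) + algebraMap k F j.1 * lam * (σ j.2 * j.2) = 0) ↔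
      (algebraMap k F i.1 * i.2 ^ 2 + algebraMap k F j.1 * j.2 ^ 2 = 0 ∧
      algebraMap k F i.1 * (σ i.2 * i.2) + algebraMap k F j.1 * (σ j.2 * j.2) = 0) := by
    intro i j
    refine and_congr ⟨fun h ↦ mul_left_cancel₀ hlam ?_, fun h ↦ ?_⟩
      ⟨fun h ↦ mul_left_cancel₀ hlam ?_, fun h ↦ ?_⟩
    · linear_combination -h
    · linear_combination -lam * h
    · linear_combination h
    · linear_combination lam * h
  simp only [h, card_filter_same this σ, card_filter_cross h2 hs σ hσ hlam]
  push_cast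
  rw [← Finset.sum_filter]
  simp only [Finset.sum_const, card_filter_zero, nsmul_eq_mul, Finset.card_univ, Fintype.card_prod]
  push_cast
  ring

end Moments

theorem pairSum_eq_traceQuadraticForm {k F : Type*} [Field k] [Fintype k] [DecidableEq k] [Field F]
    [Fintype F] [Algebra k F] (χ : AddChar k ℂ) (σ : F ≃ₐ[k] F) (lam a b : F) :
    pairSum (χ.compAddMonoidHom (Algebra.trace k F).toAddMonoidHom) σ lam a b =
      (∑ y : kˣ, ∑ x, χ (y * traceQuadraticForm σ a b x)) +
      ∑ y : kˣ, ∑ x, χ (y * traceQuadraticForm σ (-(lam * a)) (lam * b) x) := by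
  simp only [pairSum, Fintype.sum_prod_type, AddChar.compAddMonoidHom_apply,
    LinearMap.toAddMonoidHom_coe, traceQuadraticForm_apply]
  congr 1 <;>
  · refine Finset.sum_congr rfl fun y _ ↦ Finset.sum_congr rfl fun x _ ↦ ?_
    rw [← smul_eq_mul (y : k), ← map_smul, Algebra.smul_def]
    ring_nf

/-- A nonzero term requires a nonzero radical, and at most one of the two forms has one. -/
theorem pairSum_values {k K F : Type*} [Field k] [Fintype k] [DecidableEq k] [Field K] [Finite K]
    [Field F] [Fintype F] [Algebra k F] [Algebra K F] (hk : ringChar k ≠ 2) {χ : AddChar k ℂ}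
    (hχ : χ ≠ 1) (σ : F ≃ₐ[k] F) (σK : F ≃ₐ[K] F) (hσK : ∀ x, σK x = σ x)
    (hfix : ∀ x, σ x = x → ∃ c, algebraMap K F c = x) {e s : ℕ} (he : Odd e) (hs : Odd s)
    (hs3 : 3 ≤ s) (hK : Nat.card K = Fintype.card k ^ e) (hF : Module.finrank k F = e * s)
    (hσ : ∀ x, (σ : F →+* F)^[s] x = x) {lam : K} (hlam : lam ≠ 0)
    {a b : F} (hab : a ≠ 0 ∨ b ≠ 0) :
    ∃ ε : ℤ, (ε = 0 ∨ ε = 1 ∨ ε = -1) ∧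
      pairSum (χ.compAddMonoidHom (Algebra.trace k F).toAddMonoidHom) σ (algebraMap K F lam) a b =
        ε * (((Fintype.card k : ℂ) - 1) * (Fintype.card k : ℂ) ^ ((e * s + e) / 2)) := by
  set l := algebraMap K F lam with hl
  have hl0 : l ≠ 0 := by simpa [hl] using hlam
  have hσl : σ l = l := by rw [← hσK, hl, AlgEquiv.commutes]
  have h2F : (2 : F) ≠ 0 := by
    rw [← map_ofNat (algebraMap k F) 2]; simpa using Ring.two_ne_zero hk
  have hab' : -(l * a) ≠ 0 ∨ l * b ≠ 0 := by simpa [hl0] using hab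
  rw [pairSum_eq_traceQuadraticForm]
  rcases sum_units_traceQuadraticForm hk hχ σ σK hσK hfix he hs hs3 hK hF hab with
    h1 | ⟨⟨x, hx0, hx⟩, ε, hε, h1⟩ <;>
  rcases sum_units_traceQuadraticForm hk hχ σ σK hσK hfix he hs hs3 hK hF hab' with
    h2 | ⟨⟨y, hy0, hy⟩, ε', hε', h2⟩
  · exact ⟨0, Or.inl rfl, by rw [h1, h2]; simp⟩
  · exact ⟨ε', Or.inr hε', by rw [h1, h2, zero_add]⟩
  · exact ⟨ε, Or.inr hε, by rw [h1, h2, add_zero]⟩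
  · exfalso
    -- As σ fixes λ, the radical equation of the second form is λ times the one for (-a, b).
    refine (eq_zero_of_solutions_of_neg h2F (σ := (σ : F →+* F)) hs hσ hab (y := y) hx
      (mul_left_cancel₀ hl0 ?_)).elim hx0 hy0
    simp only [map_neg, map_mul, hσl] at hy
    simp only [RingHom.coe_coe, map_neg]
    linear_combination hy

/-! ### From moments to frequencies -/

theorem ncard_values_of_moments {X : Type*} [Fintype X] {g : X → ℤ} {x₀ : X} {D : ℤ}
    (hD : 2 ≤ D) (h0 : g x₀ = D) (hg : ∀ x ≠ x₀, g x = 0 ∨ g x = 1 ∨ g x = -1) :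
    ({x | g x = D}.ncard : ℤ) = 1 ∧
    ({x | g x = 1}.ncard : ℤ) - {x | g x = -1}.ncard = ∑ x, g x - D ∧
    ({x | g x = 1}.ncard : ℤ) + {x | g x = -1}.ncard = ∑ x, g x ^ 2 - D ^ 2 ∧
    ({x | g x = 0}.ncard : ℤ) + {x | g x = 1}.ncard + {x | g x = -1}.ncard =
      Fintype.card X - 1 := by
  classical
  have hc : ∀ c : ℤ, ({x | g x = c}.ncard : ℤ) = ∑ x, if g x = c then 1 else 0 := by
    intro c
    rw [Set.ncard_eq_toFinset_card', Finset.sum_boole]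
    simp
  have hs : ∀ c : ℤ, ∑ x, (if x = x₀ then c else 0) = c := by simp
  refine ⟨?_, ?_, ?_, ?_⟩
  · have : {x | g x = D} = {x₀} := by
      ext x
      simp only [Set.mem_ofPred_eq, Set.mem_singleton_iff]
      refine ⟨fun h ↦ by_contra fun hx ↦ ?_, fun h ↦ h ▸ h0⟩
      rcases hg x hx with h' | h' | h' <;> omega
    rw [this]; simp
  · rw [hc, hc, ← hs D, ← Finset.sum_sub_distrib, ← Finset.sum_sub_distrib]
    refine Finset.sum_congr rfl fun x _ ↦ ?_
    by_cases hx : x = x₀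
    · rw [hx, h0, if_neg (by omega), if_neg (by omega)]; simp
    · rcases hg x hx with h' | h' | h' <;> simp [h', hx]
  · rw [hc, hc, ← hs (D ^ 2), ← Finset.sum_add_distrib, ← Finset.sum_sub_distrib]
    refine Finset.sum_congr rfl fun x _ ↦ ?_
    by_cases hx : x = x₀
    · rw [hx, h0, if_neg (by omega), if_neg (by omega)]; simp
    · rcases hg x hx with h' | h' | h' <;> simp [h', hx]
  · have : (Fintype.card X : ℤ) = ∑ x : X, 1 := by simp
    rw [this, hc, hc, hc]
    conv_rhs => rw [← hs 1]
    rw [← Finset.sum_add_distrib, ← Finset.sum_add_distrib, ← Finset.sum_sub_distrib]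
    refine Finset.sum_congr rfl fun x _ ↦ ?_
    by_cases hx : x = x₀
    · rw [hx, h0, if_neg (by omega), if_neg (by omega), if_neg (by omega)]; simp
    · rcases hg x hx with h' | h' | h' <;> simp [h', hx]

theorem exists_algebraMap_eq_of_pow_card {K F : Type*} [Field K] [Fintype K] [Field F] [Finite F]
    [Algebra K F] {x : F} (hx : x ^ Fintype.card K = x) : ∃ c, algebraMap K F c = x := by
  refine (IsGalois.mem_range_algebraMap_iff_fixed x).mpr fun f ↦ ?_
  obtain ⟨n, rfl⟩ := (FiniteField.bijective_frobeniusAlgEquivOfAlgebraic_pow K F).2 f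
  simp only [AlgEquiv.coe_pow]
  exact Function.iterate_fixed (by simpa using hx) _

/-- The periods of a point under y ↦ y^p are closed under gcd. This identifies the fixed field of σ
with GF(p^e). -/
theorem pow_prime_pow_gcd_eq_self {M : Type*} [Monoid M] {p m n : ℕ} {x : M}
    (hm : x ^ p ^ m = x) (hn : x ^ p ^ n = x) : x ^ p ^ m.gcd n = x := by
  have h : ∀ j, x ^ p ^ j = x ↔ Function.IsPeriodicPt (fun y : M ↦ y ^ p) j x := by
    intro j
    rw [Function.IsPeriodicPt, Function.IsFixedPt, pow_iterate]
  rw [h] at *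
  exact hm.gcd hn

theorem expSumS_eq_pairSum (p k : ℕ) [Fact p.Prime] {F : Type*} [Field F] [Fintype F]
    [Algebra (ZMod p) F] {ζ : ℂ} (hζ : ζ ^ p = 1) (σ : F ≃ₐ[ZMod p] F) (hσ : ∀ x, σ x = x ^ p ^ k)
    (lam a b : F) :
    expSumS p k ζ lam a b = pairSum ((AddChar.zmodChar p hζ).compAddMonoidHom
      (Algebra.trace (ZMod p) F).toAddMonoidHom) σ lam a b := by
  rw [pairSum, ← Finset.sum_add_distrib, Fintype.sum_prod_type, expSumS]
  refine Finset.sum_congr rfl fun y _ ↦ Finset.sum_congr rfl fun x _ ↦ ?_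
  simp only [AddChar.compAddMonoidHom_apply, LinearMap.toAddMonoidHom_coe, AddChar.zmodChar_apply,
    hσ]
  congr 4 <;> ring



theorem theorem1 (p m k e s : ℕ) [Fact p.Prime] (hp : p ≠ 2) (hm : 0 < m) (hk : 0 < k)
    (he : e = Nat.gcd m k) (hms : m = e * s) (hs : Odd s) (hs3 : 3 ≤ s)
    (hkeven : Even k) (heodd : Odd e)
    {K F : Type*} [Field K] [Fintype K] [Field F] [Fintype F] [Algebra K F] [Algebra (ZMod p) F]
    (hK : Fintype.card K = p ^ e) (hF : Fintype.card F = p ^ m)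
    (lam : K) (hlam : ¬ IsSquare lam) (ζ : ℂ) (hζ : IsPrimitiveRoot ζ p) :
    (∀ a b : F, expSumS p k ζ (algebraMap K F lam) a b ∈
      ({2 * ((p : ℂ) - 1) * (p : ℂ) ^ m, ((p : ℂ) - 1) * (p : ℂ) ^ ((m + e) / 2),
        -(((p : ℂ) - 1) * (p : ℂ) ^ ((m + e) / 2)), 0} : Set ℂ)) ∧
    ({ab : F × F | expSumS p k ζ (algebraMap K F lam) ab.1 ab.2
        = 2 * ((p : ℂ) - 1) * (p : ℂ) ^ m}.ncard : ℤ) = 1 ∧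
    ({ab : F × F | expSumS p k ζ (algebraMap K F lam) ab.1 ab.2
        = ((p : ℂ) - 1) * (p : ℂ) ^ ((m + e) / 2)}.ncard : ℤ)
      = ((p : ℤ) ^ (m - e) + (p : ℤ) ^ ((m - e) / 2)) * ((p : ℤ) ^ m - 1) ∧
    ({ab : F × F | expSumS p k ζ (algebraMap K F lam) ab.1 ab.2
        = -(((p : ℂ) - 1) * (p : ℂ) ^ ((m + e) / 2))}.ncard : ℤ)
      = ((p : ℤ) ^ (m - e) - (p : ℤ) ^ ((m - e) / 2)) * ((p : ℤ) ^ m - 1) ∧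
    ({ab : F × F | expSumS p k ζ (algebraMap K F lam) ab.1 ab.2 = 0}.ncard : ℤ)
      = ((p : ℤ) ^ m - 2 * (p : ℤ) ^ (m - e) + 1) * ((p : ℤ) ^ m - 1) := by
  have hp' : p.Prime := Fact.out
  have hp2 : 2 ≤ p := hp'.two_le
  have hrc : ringChar (ZMod p) ≠ 2 := by rwa [ZMod.ringChar_zmod_n]
  have hcz : Fintype.card (ZMod p) = p := ZMod.card p
  have : Finite K := inferInstance
  have hrank : Module.finrank (ZMod p) F = m := by
    have h := Module.card_eq_pow_finrank (K := ZMod p) (V := F)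
    rw [hF, hcz] at h
    exact (Nat.pow_right_injective hp2 h).symm
  have hmodd : Odd m := hms ▸ heodd.mul hs
  obtain ⟨k', hk'⟩ : e ∣ k := he ▸ Nat.gcd_dvd_right m k
  let σ : F ≃ₐ[ZMod p] F := FiniteField.frobeniusAlgEquivOfAlgebraic (ZMod p) F ^ k
  have hσ : ∀ x, σ x = x ^ p ^ k := by
    intro x
    simp only [σ, AlgEquiv.coe_pow, FiniteField.coe_frobeniusAlgEquivOfAlgebraic_iterate, hcz]
  have hσs : ∀ x, (σ : F →+* F)^[s] x = x := by
    intro x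
    have h : ⇑(σ : F →+* F) = fun x : F ↦ x ^ p ^ k := funext hσ
    rw [h, pow_iterate, ← pow_mul, show k * s = m * k' by rw [hk', hms]; ring, pow_mul, ← hF]
    exact FiniteField.pow_card_pow k' x
  -- Since e divides k, σ is linear over GF(p^e) as well.
  let σK : F ≃ₐ[K] F := AlgEquiv.ofRingEquiv (f := σ.toRingEquiv) (by
    intro c
    change σ _ = _
    rw [hσ, ← map_pow, hk', pow_mul, ← hK, FiniteField.pow_card_pow])
  have hσK : ∀ x, σK x = σ x := fun _ ↦ rfl
  have hfix : ∀ x, σ x = x → ∃ c, algebraMap K F c = x := by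
    intro x hx
    apply exists_algebraMap_eq_of_pow_card
    rw [hK, he]
    exact pow_prime_pow_gcd_eq_self (hF ▸ FiniteField.pow_card x) (by rw [← hσ, hx])
  have hlam0 : lam ≠ 0 := by
    rintro rfl
    exact hlam IsSquare.zero
  have hl0 : algebraMap K F lam ≠ 0 := by simpa using hlam0
  have h2F : (2 : F) ≠ 0 := by
    rw [← map_ofNat (algebraMap (ZMod p) F) 2]; simpa using Ring.two_ne_zero hrc
  have hχ : AddChar.zmodChar p hζ.pow_eq_one ≠ 1 := by
    have := AddChar.zmodChar_primitive_of_primitive_root p hζ one_ne_zero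
    rwa [AddChar.mulShift_one] at this
  set ψ := (AddChar.zmodChar p hζ.pow_eq_one).compAddMonoidHom
      (Algebra.trace (ZMod p) F).toAddMonoidHom with hψdef
  have hψ : ψ ≠ 1 := by
    obtain ⟨t, ht⟩ := AddChar.ne_one_iff.mp hχ
    obtain ⟨x, hx⟩ := Algebra.trace_surjective (ZMod p) F t
    refine AddChar.ne_one_iff.mpr ⟨x, ?_⟩
    rw [hψdef, AddChar.compAddMonoidHom_apply, LinearMap.toAddMonoidHom_coe, hx]
    exact ht
  have hS : ∀ a b : F, expSumS p k ζ (algebraMap K F lam) a b =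
      pairSum ψ σ (algebraMap K F lam) a b := expSumS_eq_pairSum p k hζ.pow_eq_one σ hσ _
  simp only [hS]
  have hcu : (Fintype.card (ZMod p)ˣ : ℂ) = p - 1 := by
    rw [ZMod.card_units p, Nat.cast_sub (by omega), Nat.cast_one]
  have hcF : (Fintype.card F : ℂ) = (p : ℂ) ^ m := by rw [hF]; push_cast; rfl
  have hM1 := sum_pairSum hψ σ hl0
  have hM2 := sum_pairSum_sq hψ σ hl0 (hrank ▸ hmodd) h2F hs hσs
  have hval := fun (a b : F) (hab : a ≠ 0 ∨ b ≠ 0) ↦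
    pairSum_values hrc hχ σ σK hσK hfix heodd hs hs3 (by rw [hcz, ← hK, Nat.card_eq_fintype_card])
      (hrank.trans hms) hσs hlam0 hab
  have hzero : pairSum ψ σ (algebraMap K F lam) 0 0 = 2 * ((p : ℂ) - 1) * (p : ℂ) ^ m := by
    simp only [pairSum, zero_mul, add_zero, AddChar.map_zero_eq_one, Finset.sum_const,
      Finset.card_univ, Fintype.card_prod, nsmul_eq_mul, Nat.cast_mul, hcu, hcF]
    ring
  generalize pairSum ψ σ (algebraMap K F lam) = T at *
  obtain ⟨t, ht⟩ : ∃ t, m = 2 * t + e := by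
    obtain ⟨s', hs'⟩ := hs
    exact ⟨e * s', by rw [hms, hs']; ring⟩
  have he1 : (m + e) / 2 = t + e := by omega
  have he2 : (m - e) / 2 = t := by omega
  have he3 : m - e = 2 * t := by omega
  rw [← hms, he1, hcz] at hval
  rw [he1, he2, he3]
  rw [hcu, hcF] at hM1 hM2
  set V : ℂ := ((p : ℂ) - 1) * (p : ℂ) ^ (t + e) with hV
  have hp0 : (p : ℂ) ≠ 0 := by exact_mod_cast hp'.ne_zero
  have hV0 : V ≠ 0 := by
    refine mul_ne_zero (sub_ne_zero.mpr ?_) (pow_ne_zero _ hp0)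
    exact_mod_cast hp'.one_lt.ne'
  -- In units of V all values of S are integers; m = t + (t + e) makes the value at the origin 2p^t.
  have hVD : 2 * ((p : ℂ) - 1) * (p : ℂ) ^ m = ((2 * p ^ t : ℤ) : ℂ) * V := by
    rw [hV, ht]; push_cast; ring
  have hex : ∀ ab : F × F, ∃ n : ℤ, T ab.1 ab.2 = n * V ∧
      (ab = (0, 0) → n = 2 * p ^ t) ∧ (ab ≠ (0, 0) → n = 0 ∨ n = 1 ∨ n = -1) := by
    rintro ⟨a, b⟩
    by_cases hab : a ≠ 0 ∨ b ≠ 0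
    · obtain ⟨ε, hε, h⟩ := hval a b hab
      refine ⟨ε, h, fun h' ↦ ?_, fun _ ↦ hε⟩
      obtain ⟨rfl, rfl⟩ := Prod.mk.inj h'
      simp at hab
    · push Not at hab
      exact ⟨_, by rw [hab.1, hab.2, hzero, hVD], fun _ ↦ rfl, fun h' ↦ absurd (Prod.ext hab.1 hab.2) h'⟩
  choose g hg hg0 hg1 using hex
  have hpt : (1 : ℤ) ≤ (p : ℤ) ^ t := by exact_mod_cast Nat.one_le_pow t p hp'.pos
  have hsum1 : ∑ ab, g ab = 2 * p ^ (t + m) := by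
    simp only [hg, ← Finset.sum_mul] at hM1
    have : ((∑ ab, g ab : ℤ) : ℂ) = ((2 * p ^ (t + m) : ℤ) : ℂ) := by
      refine mul_right_cancel₀ hV0 ?_
      push_cast
      rw [hM1, hV, ht]
      ring
    exact_mod_cast this
  have hsum2 : ∑ ab, g ab ^ 2 = 2 * p ^ (2 * t) * (p ^ m + 1) := by
    simp only [hg, mul_pow, ← Finset.sum_mul] at hM2
    have : ((∑ ab, g ab ^ 2 : ℤ) : ℂ) = ((2 * p ^ (2 * t) * (p ^ m + 1) : ℤ) : ℂ) := by
      refine mul_right_cancel₀ (pow_ne_zero 2 hV0) ?_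
      push_cast
      rw [hM2, hV, ht]
      ring
    exact_mod_cast this
  obtain ⟨hc1, hc2, hc3, hc4⟩ := ncard_values_of_moments (g := g) (x₀ := ((0, 0) : F × F))
    (D := 2 * p ^ t) (by omega) (hg0 _ rfl) hg1
  have hcard : (Fintype.card (F × F) : ℤ) = p ^ (2 * m) := by
    rw [Fintype.card_prod, hF]; push_cast; ring
  rw [hsum1] at hc2
  rw [hsum2] at hc3
  rw [hcard] at hc4
  have hset : ∀ n : ℤ, {ab : F × F | T ab.1 ab.2 = n * V} = {ab | g ab = n} := by
    intro n
    ext ab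
    simp only [Set.mem_ofPred_eq, hg]
    rw [mul_left_inj' hV0]
    exact_mod_cast Iff.rfl
  have hset1 : {ab : F × F | T ab.1 ab.2 = V} = {ab | g ab = 1} := by
    rw [← hset]; simp
  have hsetn : {ab : F × F | T ab.1 ab.2 = -V} = {ab | g ab = -1} := by
    rw [← hset]; simp
  have hsetz : {ab : F × F | T ab.1 ab.2 = 0} = {ab | g ab = 0} := by
    rw [← hset]; simp
  rw [hVD, hset, hset1, hsetn, hsetz]
  rw [pow_add] at hc2
  rw [pow_mul'] at hc3 hc4 ⊢
  -- For the frequencies N₁ and N₋₁ of ±V, the moments now read N₁ - N₋₁ = 2p^t(p^m - 1) and N₁ +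
  -- N₋₁ = 2p^(2t)(p^m - 1); the zeros are the rest of the p^(2m) - 1 nonzero pairs.
  refine ⟨fun a b ↦ ?_, hc1, ?_, ?_, ?_⟩
  · rw [hg (a, b)]
    by_cases hab : (a, b) = (0, 0)
    · rw [hg0 _ hab]; simp
    · rcases hg1 _ hab with h | h | h <;> simp [h]
  · linarith
  · linarith
  · linarith
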